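/- **Setting.** For a finite field $\mathbb F_{2^n}$ fix any $\mathbb F_2$-linear isomorphism $\mathbb F_{2^n}\cong\mathbb F_2^n$ (coordinates with respect to a basis), so that a polynomial $p\in\mathbb F_2[X_1,\dots,X_n]$ can be evaluated at elements of $\mathbb F_{2^n}$. A distribution $\mathscr P$ on $\mathbb F_2[X_1,\dots,X_n]$ is *shift-invariant* if, for every $s\in\mathbb F_2^n$, sampling $p\sim\mathscr P$ and outputting $p(X+s)$ again has distribution $\mathscr P$; it is *2-wise independent* if $\Pr_{p\sim\mathscr P}[p(x)=a\wedge p(y)=b]=\frac14$ for all $x\ne y$ in $\mathbb F_2^n$ and all $a,b\in\mathbb F_2$. A function $f:\mathbb N\to[0,1]$ is *negligible* if $N^c f(N)\to0$ as $N\to\infty$ for every $c\in\mathbb N$. Let $\gamma_1,\dots,\gamma_m\in\mathbb F_{2^n}$ be distinct, let $k$ be $(1-\alpha)m$ rounded up or down to an integer, and let $C^\perp=\{(f(\gamma_1),\dots,f(\gamma_m)) : f\in\mathbb F_{2^n}[X],\ \deg f<k\}$ be the Reed–Solomon code; let $C=\{y\in\mathbb F_{2^n}^m:\ x\cdot y=0\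 \ \forall x\in C^\perp\}$. Let $\mathrm{hw}(x)$ be the number of nonzero coordinates of $x\in\mathbb F_{2^n}^m$. For $z\in\mathbb F_{2^n}^m$ let $L(z)$ be the list of all $x\in C^\perp$ with $\mathrm{hw}(x-z)\le m-\sqrt{km}$, and let $\mathsf{Decode}(z)$ be the unique $x\in L(z)$ with $\mathrm{hw}(z-x)\le(\frac12+\varepsilon)m$ if there is exactly one such $x$, and $0$ otherwise. Put $$\mathcal G=\{e\in\mathbb F_{2^n}^m:\ \mathsf{Decode}(x+e)=x\ \ \forall x\in C^\perp\},\qquad \mathsf{BAD}=(\mathbb F_{2^n}^m\times\mathbb F_{2^n}^m)\setminus(C^\perp\times\mathcal G).$$ Let $V:\mathbb F_{2^n}^m\to\mathbb C$ be $|C|^{-1/2}$ on $C$ and $0$ elsewhere. For $\mathcal P=(p_1,\dots,p_m)$ let $R=\{e\in\mathbb F_{2^n}^m:\ p_i(e_i)=0\ \text{for all } i\}$ and let $W^{\mathcal P}$ be $|R|^{-1/2}$ on $R$ and $0$ elsewhere (identically $0$ if $R=\emptyset$). For $f:\mathbb F_{2^n}^m\to\mathbb C$ let $$\hat f(z)=2^{-nm/2}\sum_{x\in\mathbb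 F_{2^n}^m}f(x)\,(-1)^{\mathrm{Tr}(x\cdot z)},$$ where $\mathrm{Tr}$ is the absolute trace $\mathbb F_{2^n}\to\mathbb F_2$. **Lemma.** Let $n=n(\lambda)=\Theta(\lambda)$ and $m=m(\lambda)=\omega(\log n)$, and let $\varepsilon,\alpha$ be constants with $0<\varepsilon<\frac16$ and $\frac78+\frac34\varepsilon<\alpha<1$. Then there are negligible functions $\delta,\eta:\mathbb N\to[0,1]$ such that for all sufficiently large $\lambda$ the following holds for every field $\mathbb F_{2^n}$ with coordinates, every choice of distinct $\gamma_1,\dots,\gamma_m\in\mathbb F_{2^n}$ and $k$ as above, and all distributions $\mathscr P_1,\dots,\mathscr P_m$ on $\mathbb F_2[X_1,\dots,X_n]$ that are shift-invariant and 2-wise independent: if $p_1,\dots,p_m$ are sampled independently with $p_i\sim\mathscr P_i$, then with probability at least $1-\eta(n)$ over $\mathcal P=(p_1,\dots,p_m)$, $$\sum_{z\in\mathbb F_{2^n}^m}\Bigl|\sum_{(x,e)\in\mathsf{BAD},\ x+e=z}\hat V(x)\,\hat W^{\mathcal P}(e)\Bigr|^2\le\delta(\lambda).$$ -/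

import Mathlib

open Filter Asymptotics MeasureTheory
open scoped Matrix

noncomputable section

namespace PolySystem

/-- A function `f : ℕ → ℝ` is negligible: `N ^ c * f N → 0` for every natural number `c`. -/
def Negligible (f : ℕ → ℝ) : Prop :=
  SuperpolynomialDecay atTop (fun N : ℕ => (N : ℝ)) f

/-! ### Distributions of polynomials over the field with two elements -/

/-- The ring `𝔽₂[X₁, …, Xₙ]`. -/
abbrev BoolPoly (n : ℕ) : Type := MvPolynomial (Fin n) (ZMod 2)

/-- The (countable) set of polynomials carries the discrete σ-algebra. -/
instance instMeasurableSpaceBoolPoly (n : ℕ) : MeasurableSpace (BoolPoly n) := ⊤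

/-- The polynomial `p(X + s)`. -/
def shift {n : ℕ} (s : Fin n → ZMod 2) (p : BoolPoly n) : BoolPoly n :=
  MvPolynomial.bind₁ (fun j => MvPolynomial.X j + MvPolynomial.C (s j)) p

/-- Sampling `p` and outputting `p(X + s)` gives the same distribution, for every `s`. -/
def ShiftInvariant {n : ℕ} (D : PMF (BoolPoly n)) : Prop :=
  ∀ s : Fin n → ZMod 2, D.map (shift s) = D

/-- The values at any two distinct points are independent uniform bits. -/
def TwoWiseIndependent {n : ℕ} (D : PMF (BoolPoly n)) : Prop :=
  ∀ x y : Fin n → ZMod 2, x ≠ y → ∀ a b : ZMod 2,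
    D.toMeasure {p | MvPolynomial.eval x p = a ∧ MvPolynomial.eval y p = b} = 1 / 4

/-- The law of `(p₁, …, pₘ)` with the `pᵢ` sampled independently, `pᵢ` from `D i`. -/
def systemLaw {n m : ℕ} (D : Fin m → PMF (BoolPoly n)) : Measure (Fin m → BoolPoly n) :=
  Measure.pi fun i => (D i).toMeasure

/-! ### Codes -/

section Codes

variable {K : Type} [Field K] {m : ℕ}

/-- The Reed-Solomon code with evaluation points `γ` and dimension parameter `k`: all vectors
`(f(γ₁), …, f(γₘ))` with `f` a polynomial of degree less than `k`. -/
def rsCode (γ : Fin m → K) (k : ℕ) : Submodule K (Fin m → K) :=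
  (Polynomial.degreeLT K k).map (LinearMap.pi fun i => Polynomial.leval (γ i))

/-- The dual code, with respect to the dot product. -/
def dualCode (C : Submodule K (Fin m → K)) : Submodule K (Fin m → K) where
  carrier := {y | ∀ x ∈ C, x ⬝ᵥ y = 0}
  add_mem' := fun {a b} ha hb x hx => by rw [dotProduct_add, ha x hx, hb x hx, add_zero]
  zero_mem' := fun x _ => dotProduct_zero x
  smul_mem' := fun c a ha x hx => by rw [dotProduct_smul, ha x hx, smul_zero]

open Classical in
/-- The list of all codewords of the Reed-Solomon code at Hamming distance at most
`m - √(k m)` from `z`. -/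
def listDecode (γ : Fin m → K) (k : ℕ) (z : Fin m → K) : Set (Fin m → K) :=
  {x | x ∈ rsCode γ k ∧ (hammingNorm (x - z) : ℝ) ≤ m - √((k : ℝ) * m)}

open Classical in
/-- If the list of `z` contains exactly one `x` whose Hamming distance from `z` is at most
`(1/2 + ε) m`, then this `x`; otherwise `0`. -/
def decode (γ : Fin m → K) (k : ℕ) (ε : ℝ) (z : Fin m → K) : Fin m → K :=
  if h : ∃! x, x ∈ listDecode γ k z ∧ (hammingNorm (z - x) : ℝ) ≤ (1 / 2 + ε) * m
  then h.choose else 0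

/-- The error vectors that are decoded correctly whatever the codeword is. -/
def goodErrors (γ : Fin m → K) (k : ℕ) (ε : ℝ) : Set (Fin m → K) :=
  {e | ∀ x ∈ rsCode γ k, decode γ k ε (x + e) = x}

/-- The complement of the product of the Reed-Solomon code and the set of good errors. -/
def bad (γ : Fin m → K) (k : ℕ) (ε : ℝ) : Set ((Fin m → K) × (Fin m → K)) :=
  ((rsCode γ k : Set (Fin m → K)) ×ˢ goodErrors γ k ε)ᶜ

end Codes

/-! ### Amplitudes and their Fourier transforms -/

section Amplitudes

variable {K : Type} [Field K] [Fintype K] [Algebra (ZMod 2) K] {m n : ℕ}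

/-- The quantum Fourier transform over a finite field of characteristic two, with respect to the
absolute trace: `|K|^(-m/2) ∑ₓ f(x) (-1)^(Tr(x ⬝ z))`. -/
def fourier (f : (Fin m → K) → ℂ) (z : Fin m → K) : ℂ :=
  (1 / (√((Fintype.card K : ℝ) ^ m) : ℂ)) *
    ∑ x : Fin m → K, f x * (-1) ^ (Algebra.trace (ZMod 2) K (x ⬝ᵥ z)).val

open Classical in
/-- The normalized indicator function `|S|^(-1/2) 1_S`; it is `0` if `S` is empty. -/
def uniformAmplitude (S : Set (Fin m → K)) (x : Fin m → K) : ℂ :=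
  if x ∈ S then 1 / (√(S.ncard : ℝ) : ℂ) else 0

/-- The common roots of a system: the vectors `e` over `K` such that `pᵢ` vanishes at the
coordinate vector of `eᵢ`, for every `i`. -/
def roots (φ : K ≃ₗ[ZMod 2] (Fin n → ZMod 2)) (P : Fin m → BoolPoly n) : Set (Fin m → K) :=
  {e | ∀ i, MvPolynomial.eval (φ (e i)) (P i) = 0}

/-- The amplitude `V`: uniform on the primal code, the dual of the Reed-Solomon code. -/
def ampV (γ : Fin m → K) (k : ℕ) : (Fin m → K) → ℂ :=
  uniformAmplitude (dualCode (rsCode γ k) : Set (Fin m → K))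

/-- The amplitude `W`: uniform on the common roots of the system. -/
def ampW (φ : K ≃ₗ[ZMod 2] (Fin n → ZMod 2)) (P : Fin m → BoolPoly n) : (Fin m → K) → ℂ :=
  uniformAmplitude (roots φ P)

open Classical in
/-- The squared norm of the bad part after addition of the two registers:
`∑_z |∑_{(x, e) ∈ BAD, x + e = z} V̂(x) Ŵ(e)|²`. -/
def badMass (γ : Fin m → K) (k : ℕ) (ε : ℝ) (φ : K ≃ₗ[ZMod 2] (Fin n → ZMod 2))
    (P : Fin m → BoolPoly n) : ℝ :=
  ∑ z : Fin m → K,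
    ‖∑ xe : (Fin m → K) × (Fin m → K) with xe ∈ bad γ k ε ∧ xe.1 + xe.2 = z,
      fourier (ampV γ k) xe.1 * fourier (ampW φ P) xe.2‖ ^ 2

end Amplitudes

end PolySystem

end

open PolySystem

namespace PolySystem

set_option linter.unusedSectionVars false

/-! ### The trace character -/

section Characters

variable {K : Type} [Field K] [Fintype K] [Algebra (ZMod 2) K] {m n : ℕ}

/-! The argument bounds the expected bad mass and finishes with Markov's inequality. The transform
of `ampV` vanishes off the Reed-Solomon code (`realFourier_dualCode_eq_zero`), so a pair contributes
only through an `e` outside `goodErrors`. The transform of `ampW` is a product of one-coordinate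
coefficients (`fourier_ampW`). Translating the polynomial multiplies each coefficient by a
character, so shift-invariance makes distinct coefficients uncorrelated. In expectation all cross
terms disappear, and since the transform of `ampV` has total mass at most 1, what remains is at most
the sum of `∏ i, weight φ (D i) (e i)` over the errors that are not good (`integral_badMass_le`).

By 2-wise independence each coordinate weight is 1/2 at zero and at most 2/q elsewhere
(`weight_zero`, `weight_le`), where q is the field size; its total is at most 1 by Parseval. Thus e
behaves like a vector whose coordinates vanish with probability 1/2 and are otherwise spread out. An
error can fail to be good only if it is heavy or agrees with a nonzero codeword in at least (1/2 -
ε)m places (`heavy_or_agree_of_notMem_goodErrors`). Both events are controlled by exponential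
moments (`sum_heavy_le`, `sum_agree_le`), the second with a union bound over at most q^k codewords.
The rate condition on α makes the two factors q^k lose against q^(-(1/2 - ε)m). -/

/-- The real-valued additive character `x ↦ (-1)^(Tr x)`. -/
noncomputable def traceSign (K : Type) [Field K] [Fintype K] [Algebra (ZMod 2) K] :
    AddChar K ℝ where
  toFun x := (-1) ^ (Algebra.trace (ZMod 2) K x).val
  map_zero_eq_one' := by simp
  map_add_eq_mul' x y := by
    rw [map_add]
    generalize Algebra.trace (ZMod 2) K x = a
    generalize Algebra.trace (ZMod 2) K y = b
    have two (c : ZMod 2) : c = 0 ∨ c = 1 := by revert c; decide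
    rcases two a with rfl | rfl <;> rcases two b with rfl | rfl <;>
      simp [CharTwo.add_self_eq_zero, ZMod.val_one]

lemma traceSign_apply (x : K) :
    traceSign K x = (-1) ^ (Algebra.trace (ZMod 2) K x).val := rfl

lemma traceSign_mul_self (x : K) : traceSign K x * traceSign K x = 1 := by
  rw [traceSign_apply, ← pow_add, ← two_mul, pow_mul]; simp

lemma abs_traceSign (x : K) : |traceSign K x| = 1 := by
  rw [traceSign_apply, abs_pow]; simp

lemma exists_traceSign_eq_neg_one {a : K} (ha : a ≠ 0) : ∃ b, traceSign K (b * a) = -1 := by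
  obtain ⟨b, hb⟩ := Algebra.trace_surjective (ZMod 2) K 1
  refine ⟨b / a, ?_⟩
  rw [div_mul_cancel₀ _ ha, traceSign_apply, hb]
  simp [ZMod.val_one]

lemma add_self_eq_zero_of_algebra (a : K) : a + a = 0 := by
  rw [← two_nsmul, ← Nat.cast_smul_eq_nsmul (ZMod 2), show ((2 : ℕ) : ZMod 2) = 0 from rfl,
    zero_smul]

/-- Since x has a nonzero coordinate, some translation of z along that coordinate flips every sign,
so the sum equals its own negative. -/
lemma sum_traceSign_dotProduct {x : Fin m → K} (hx : x ≠ 0) :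
    ∑ z : Fin m → K, traceSign K (x ⬝ᵥ z) = 0 := by
  obtain ⟨i, hi⟩ := Function.ne_iff.1 hx
  rw [Pi.zero_apply] at hi
  obtain ⟨b, hb⟩ := exists_traceSign_eq_neg_one hi
  have hz (z : Fin m → K) : traceSign K (x ⬝ᵥ (z + Pi.single i b)) = -traceSign K (x ⬝ᵥ z) := by
    rw [dotProduct_add, dotProduct_single, AddChar.map_add_eq_mul, mul_comm (x i), hb, mul_neg_one]
  have h := Equiv.sum_comp (Equiv.addRight (Pi.single i b)) fun z => traceSign K (x ⬝ᵥ z)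
  simp only [Equiv.coe_addRight, hz, Finset.sum_neg_distrib] at h
  linarith

lemma sum_traceSign_dotProduct_mul [DecidableEq (Fin m → K)] (x y : Fin m → K) :
    ∑ z : Fin m → K, traceSign K (x ⬝ᵥ z) * traceSign K (y ⬝ᵥ z) =
      if x = y then (Fintype.card K : ℝ) ^ m else 0 := by
  split_ifs with h
  · simp [h, traceSign_mul_self]
  · simp_rw [← AddChar.map_add_eq_mul, ← add_dotProduct]
    refine sum_traceSign_dotProduct fun h0 => h ?_
    ext i
    have := congrFun h0 i
    have h2 := add_self_eq_zero_of_algebra (y i)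
    simp only [Pi.add_apply, Pi.zero_apply] at this
    exact add_right_cancel (this.trans h2.symm)

lemma sum_traceSign_mul_mul [DecidableEq K] (x y : K) :
    ∑ z : K, traceSign K (x * z) * traceSign K (y * z) =
      if x = y then (Fintype.card K : ℝ) else 0 := by
  split_ifs with h
  · simp [h, traceSign_mul_self]
  · simp_rw [← AddChar.map_add_eq_mul, ← add_mul]
    have hxy : x + y ≠ 0 := fun h0 =>
      h (add_right_cancel (h0.trans (add_self_eq_zero_of_algebra y).symm))
    obtain ⟨b, hb⟩ := exists_traceSign_eq_neg_one hxy
    have h : ∑ z : K, traceSign K ((x + y) * (z + b)) = ∑ z : K, traceSign K ((x + y) * z) :=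
      Equiv.sum_comp (Equiv.addRight b) fun z => traceSign K ((x + y) * z)
    simp only [mul_add (x + y), mul_comm (x + y) b, AddChar.map_add_eq_mul, hb,
      ← Finset.sum_mul] at h
    linarith

end Characters

/-- Parseval's identity for a finite system of orthogonal vectors. -/
lemma sum_sq_sum_of_orthogonal {X Z : Type*} [Fintype X] [Fintype Z] [DecidableEq X]
    (f : X → ℝ) (E : X → Z → ℝ) (c : ℝ)
    (hE : ∀ x y, ∑ z, E x z * E y z = if x = y then c else 0) :
    ∑ z, (∑ x, f x * E x z) ^ 2 = c * ∑ x, f x ^ 2 := by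
  have h (z : Z) : (∑ x, f x * E x z) ^ 2 = ∑ x, ∑ y, f x * f y * (E x z * E y z) := by
    rw [sq, Finset.sum_mul_sum]
    exact Finset.sum_congr rfl fun x _ => Finset.sum_congr rfl fun y _ => by ring
  simp_rw [h]
  rw [Finset.sum_comm, Finset.mul_sum]
  refine Finset.sum_congr rfl fun x _ => ?_
  rw [Finset.sum_comm]
  simp_rw [← Finset.mul_sum, hE]
  simp
  ring

/-- Parseval's identity for a finite system of orthogonal random variables. -/
lemma integral_sq_sum_of_orthogonal {X Ω : Type*} [Fintype X] [DecidableEq X]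
    [MeasurableSpace Ω] (μ : Measure Ω) (f : X → ℝ) (g : X → Ω → ℝ) (c : X → ℝ)
    (hi : ∀ x y, Integrable (fun ω => g x ω * g y ω) μ)
    (hg : ∀ x y, ∫ ω, g x ω * g y ω ∂μ = if x = y then c x else 0) :
    Integrable (fun ω => (∑ x, f x * g x ω) ^ 2) μ ∧
      ∫ ω, (∑ x, f x * g x ω) ^ 2 ∂μ = ∑ x, f x ^ 2 * c x := by
  have h : (fun ω => (∑ x, f x * g x ω) ^ 2) =
      fun ω => ∑ x, ∑ y, f x * f y * (g x ω * g y ω) := by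
    funext ω
    rw [sq, Finset.sum_mul_sum]
    exact Finset.sum_congr rfl fun x _ => Finset.sum_congr rfl fun y _ => by ring
  rw [h]
  refine ⟨integrable_finsetSum _ fun x _ => integrable_finsetSum _ fun y _ =>
    (hi x y).const_mul _, ?_⟩
  rw [integral_finsetSum _ fun x _ => integrable_finsetSum _ fun y _ => (hi x y).const_mul _]
  refine Finset.sum_congr rfl fun x _ => ?_
  rw [integral_finsetSum _ fun y _ => (hi x y).const_mul _]
  simp_rw [integral_const_mul, hg]
  simp [sq]

/-! ### The amplitude of the primal code -/

section Primal

variable {K : Type} [Field K] [Fintype K] [Algebra (ZMod 2) K] {m : ℕ}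

/-- The Fourier transform of a real-valued amplitude, as a real function. -/
noncomputable def realFourier (f : (Fin m → K) → ℝ) (z : Fin m → K) : ℝ :=
  1 / √((Fintype.card K : ℝ) ^ m) * ∑ x : Fin m → K, f x * traceSign K (x ⬝ᵥ z)

lemma fourier_ofReal (f : (Fin m → K) → ℝ) (z : Fin m → K) :
    fourier (fun x => (f x : ℂ)) z = (realFourier f z : ℂ) := by
  simp [fourier, realFourier, traceSign_apply]

lemma card_pow_pos : 0 < (Fintype.card K : ℝ) ^ m :=
  pow_pos (Nat.cast_pos.2 Fintype.card_pos) m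

lemma sum_realFourier_sq (f : (Fin m → K) → ℝ) :
    ∑ z, realFourier f z ^ 2 = ∑ x, f x ^ 2 := by
  classical
  have h := sum_sq_sum_of_orthogonal f (fun x z : Fin m → K => traceSign K (x ⬝ᵥ z)) _
    sum_traceSign_dotProduct_mul
  simp_rw [realFourier, mul_pow, ← Finset.mul_sum, h, div_pow, one_pow,
    Real.sq_sqrt (card_pow_pos (K := K) (m := m)).le]
  have := (card_pow_pos (K := K) (m := m)).ne'
  field_simp

open Classical in
/-- The normalized indicator function with real values. -/
noncomputable def realUniform (S : Set (Fin m → K)) (x : Fin m → K) : ℝ :=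
  if x ∈ S then 1 / √(S.ncard : ℝ) else 0

lemma uniformAmplitude_eq (S : Set (Fin m → K)) :
    uniformAmplitude S = fun x => (realUniform S x : ℂ) := by
  funext x
  simp only [uniformAmplitude, realUniform]
  split_ifs <;> simp

lemma sum_realUniform_sq_le_one (S : Set (Fin m → K)) : ∑ x, realUniform S x ^ 2 ≤ 1 := by
  classical
  have h (x : Fin m → K) : realUniform S x ^ 2 = if x ∈ S then 1 / (S.ncard : ℝ) else 0 := by
    simp only [realUniform]
    split_ifs
    · rw [div_pow, one_pow, Real.sq_sqrt (Nat.cast_nonneg _)]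
    · simp
  simp_rw [h]
  rw [← Finset.sum_filter, Finset.sum_const, nsmul_eq_mul, Set.ncard_eq_toFinset_card',
    ← Set.filter_mem_univ_eq_toFinset]
  exact (mul_one_div _ _).trans_le (div_self_le_one _)

/-- A linear functional vanishing on C but not at x separates them; its coordinate vector is the
required element of the dual code. -/
lemma exists_mem_dualCode_of_notMem {C : Submodule K (Fin m → K)} {x : Fin m → K} (hx : x ∉ C) :
    ∃ y ∈ dualCode C, y ⬝ᵥ x ≠ 0 := by
  obtain ⟨f, hf, hC⟩ := Submodule.exists_le_ker_of_notMem hx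
  have key (v : Fin m → K) : f v = v ⬝ᵥ fun i => f fun j => if i = j then 1 else 0 := by
    rw [LinearMap.pi_apply_eq_sum_univ f v]; rfl
  refine ⟨fun i => f fun j => if i = j then 1 else 0, fun v hv => ?_, ?_⟩
  · rw [← key]; exact hC hv
  · rw [dotProduct_comm, ← key]; exact hf

/-- The dual code is stable under translation by every K-multiple of y. A suitable multiple `b • y`
turns the character at x into its negative, so the sum cancels. -/
lemma realFourier_dualCode_eq_zero {C : Submodule K (Fin m → K)} {x : Fin m → K} (hx : x ∉ C) :
    realFourier (realUniform (dualCode C : Set (Fin m → K))) x = 0 := by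
  obtain ⟨y, hy, hyx⟩ := exists_mem_dualCode_of_notMem hx
  obtain ⟨b, hb⟩ := exists_traceSign_eq_neg_one hyx
  set u := realUniform (dualCode C : Set (Fin m → K))
  have hu (v : Fin m → K) : u (v + b • y) = u v := by
    have hmem : v + b • y ∈ (dualCode C : Set (Fin m → K)) ↔
        v ∈ (dualCode C : Set (Fin m → K)) :=
      (dualCode C).add_mem_iff_left ((dualCode C).smul_mem b hy)
    unfold u realUniform
    by_cases hv : v ∈ (dualCode C : Set (Fin m → K))
    · rw [if_pos hv, if_pos (hmem.2 hv)]
    · rw [if_neg hv, if_neg (hmem.not.2 hv)]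
  have h : ∑ v, u v * traceSign K (v ⬝ᵥ x) =
      ∑ v, u (v + b • y) * traceSign K ((v + b • y) ⬝ᵥ x) :=
    (Fintype.sum_equiv (Equiv.addRight (b • y)) _ _ fun _ => rfl).symm
  simp only [hu, add_dotProduct, smul_dotProduct, smul_eq_mul, AddChar.map_add_eq_mul, hb,
    ← mul_assoc, ← Finset.sum_mul] at h
  rw [realFourier, show ∑ v, u v * traceSign K (v ⬝ᵥ x) = 0 by linarith, mul_zero]

end Primal

/-! ### The amplitude of the roots of one polynomial -/

section Coordinate

variable {K : Type} [Field K] [Fintype K] [Algebra (ZMod 2) K] {m n : ℕ}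

open Classical in
/-- The zeros in `K` of one polynomial. -/
noncomputable def zeros (φ : K ≃ₗ[ZMod 2] (Fin n → ZMod 2)) (p : BoolPoly n) : Finset K :=
  {x | MvPolynomial.eval (φ x) p = 0}

/-- The Fourier transform of the uniform amplitude on the zeros of one polynomial. -/
noncomputable def coordAmp (φ : K ≃ₗ[ZMod 2] (Fin n → ZMod 2)) (a : K) (p : BoolPoly n) : ℝ :=
  1 / √(Fintype.card K) * (1 / √((zeros φ p).card) * ∑ x ∈ zeros φ p, traceSign K (x * a))

/-- The common roots form a product of one-coordinate zero sets, and the character is multiplicative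
over coordinates. If some zero set is empty, both sides vanish, the convention `1 / 0 = 0` included.
-/
lemma fourier_ampW (φ : K ≃ₗ[ZMod 2] (Fin n → ZMod 2)) (P : Fin m → BoolPoly n)
    (e : Fin m → K) :
    fourier (ampW φ P) e = ((∏ i, coordAmp φ (e i) (P i) : ℝ) : ℂ) := by
  classical
  have hR : roots φ P = (Fintype.piFinset fun i => zeros φ (P i) : Finset (Fin m → K)) := by
    ext x; simp [roots, zeros]
  rw [ampW, uniformAmplitude_eq, fourier_ofReal]
  congr 1
  simp only [realFourier, realUniform, coordAmp, Finset.prod_mul_distrib, hR,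
    Set.ncard_coe_finset, Finset.mem_coe, Fintype.card_piFinset]
  congr 1
  · have h := Real.sqrt_prod (Finset.univ : Finset (Fin m)) (x := fun _ => (Fintype.card K : ℝ))
      fun _ _ => Nat.cast_nonneg _
    simp only [Finset.prod_const, Finset.card_univ, Fintype.card_fin] at h ⊢
    rw [h, div_pow, one_pow]
  · simp only [ite_mul, zero_mul]
    rw [← Finset.sum_filter, Finset.filter_univ_mem, ← Finset.mul_sum, Finset.prod_univ_sum]
    congr 1
    · rw [Nat.cast_prod, Real.sqrt_prod _ fun _ _ => Nat.cast_nonneg _, Finset.prod_div_distrib]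
      simp
    · refine Finset.sum_congr rfl fun x _ => ?_
      exact map_prod (traceSign K).toMonoidHom (fun i => Multiplicative.ofAdd (x i * e i)) _

lemma coordAmp_sq (φ : K ≃ₗ[ZMod 2] (Fin n → ZMod 2)) (a : K) (p : BoolPoly n) :
    coordAmp φ a p ^ 2 = (∑ x ∈ zeros φ p, traceSign K (x * a)) ^ 2 /
      (Fintype.card K * (zeros φ p).card) := by
  rw [coordAmp, mul_pow, mul_pow, div_pow, div_pow, Real.sq_sqrt (Nat.cast_nonneg _),
    Real.sq_sqrt (Nat.cast_nonneg _)]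
  ring

lemma coordAmp_zero_sq (φ : K ≃ₗ[ZMod 2] (Fin n → ZMod 2)) (p : BoolPoly n) :
    coordAmp φ 0 p ^ 2 = (zeros φ p).card / Fintype.card K := by
  rw [coordAmp_sq]
  simp only [mul_zero, AddChar.map_zero_eq_one, Finset.sum_const, nsmul_eq_mul, mul_one]
  rcases (zeros φ p).card.eq_zero_or_pos with h | h
  · simp [h]
  · have : (0 : ℝ) < (zeros φ p).card := Nat.cast_pos.2 h
    field_simp

lemma abs_sum_traceSign_le (s : Finset K) (a : K) :
    |∑ x ∈ s, traceSign K (x * a)| ≤ s.card :=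
  (Finset.abs_sum_le_sum_abs _ _).trans (by simp [abs_traceSign])

lemma coordAmp_sq_le (φ : K ≃ₗ[ZMod 2] (Fin n → ZMod 2)) (a : K) (p : BoolPoly n) :
    coordAmp φ a p ^ 2 ≤ (zeros φ p).card / Fintype.card K := by
  rw [← coordAmp_zero_sq, coordAmp_sq, coordAmp_sq]
  gcongr ?_ / _
  rw [sq_le_sq]
  refine (abs_sum_traceSign_le _ _).trans ?_
  simp

lemma abs_coordAmp_le_one (φ : K ≃ₗ[ZMod 2] (Fin n → ZMod 2)) (a : K) (p : BoolPoly n) :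
    |coordAmp φ a p| ≤ 1 := by
  rw [← sq_le_one_iff_abs_le_one]
  refine (coordAmp_sq_le φ a p).trans (div_le_one_of_le₀ ?_ (Nat.cast_nonneg _))
  exact_mod_cast Finset.card_le_univ _

/-- This is Parseval for the indicator of the zeros; the inequality is strict only when there are no
zeros. -/
lemma sum_coordAmp_sq_le_one (φ : K ≃ₗ[ZMod 2] (Fin n → ZMod 2)) (p : BoolPoly n) :
    ∑ a, coordAmp φ a p ^ 2 ≤ 1 := by
  classical
  have h := sum_sq_sum_of_orthogonal (fun x : K => if x ∈ zeros φ p then (1 : ℝ) else 0)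
    (fun x a : K => traceSign K (x * a)) _ sum_traceSign_mul_mul
  simp only [ite_mul, one_mul, zero_mul, Finset.sum_ite_mem, Finset.univ_inter, ite_pow, one_pow,
    ne_eq, OfNat.ofNat_ne_zero, not_false_eq_true, zero_pow, Finset.sum_const, nsmul_eq_mul,
    mul_one] at h
  simp_rw [coordAmp_sq, ← Finset.sum_div, h]
  exact div_self_le_one _

lemma eval_shift (s x : Fin n → ZMod 2) (p : BoolPoly n) :
    MvPolynomial.eval x (shift s p) = MvPolynomial.eval (x + s) p := by
  rw [shift, ← MvPolynomial.coe_aeval_eq_eval, RingHom.coe_coe, MvPolynomial.aeval_bind₁,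
    ← MvPolynomial.coe_aeval_eq_eval, RingHom.coe_coe]
  congr 2
  funext j
  simp

lemma coordAmp_shift (φ : K ≃ₗ[ZMod 2] (Fin n → ZMod 2)) (a t : K) (p : BoolPoly n) :
    coordAmp φ a (shift (φ t) p) = traceSign K (t * a) * coordAmp φ a p := by
  have hz : zeros φ p = (zeros φ (shift (φ t) p)).map (Equiv.addRight t).toEmbedding := by
    ext x
    simp only [zeros, Finset.mem_filter_univ, Finset.mem_map_equiv, eval_shift, ← map_add]
    simp
  simp only [coordAmp, hz, Finset.card_map, Finset.sum_map, Equiv.coe_toEmbedding,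
    Equiv.coe_addRight, add_mul, AddChar.map_add_eq_mul, ← Finset.sum_mul]
  linear_combination -(1 / √(Fintype.card K : ℝ) *
    (1 / √((zeros φ (shift (φ t) p)).card : ℝ) *
      ∑ x ∈ zeros φ (shift (φ t) p), traceSign K (x * a))) * traceSign_mul_self (t * a)

end Coordinate

/-! ### Second moments for one random polynomial -/

section OnePolynomial

variable {K : Type} [Field K] [Fintype K] [Algebra (ZMod 2) K] {m n : ℕ}

/-- The expected squared amplitude at `a`. -/
noncomputable def weight (φ : K ≃ₗ[ZMod 2] (Fin n → ZMod 2)) (D : PMF (BoolPoly n)) (a : K) : ℝ :=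
  ∫ p, coordAmp φ a p ^ 2 ∂D.toMeasure

lemma integrable_of_abs_le (D : PMF (BoolPoly n)) {f : BoolPoly n → ℝ} (C : ℝ)
    (hf : ∀ p, |f p| ≤ C) : Integrable f D.toMeasure :=
  Integrable.of_bound Measurable.of_discrete.aestronglyMeasurable C (ae_of_all _ hf)

lemma integrable_coordAmp_mul (φ : K ≃ₗ[ZMod 2] (Fin n → ZMod 2)) (D : PMF (BoolPoly n))
    (a b : K) : Integrable (fun p => coordAmp φ a p * coordAmp φ b p) D.toMeasure :=
  integrable_of_abs_le D 1 fun p => by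
    rw [abs_mul]
    exact mul_le_one₀ (abs_coordAmp_le_one φ a p) (abs_nonneg _) (abs_coordAmp_le_one φ b p)

lemma integrable_coordAmp_sq (φ : K ≃ₗ[ZMod 2] (Fin n → ZMod 2)) (D : PMF (BoolPoly n))
    (a : K) : Integrable (fun p => coordAmp φ a p ^ 2) D.toMeasure := by
  simpa only [sq] using integrable_coordAmp_mul φ D a a

lemma weight_nonneg (φ : K ≃ₗ[ZMod 2] (Fin n → ZMod 2)) (D : PMF (BoolPoly n)) (a : K) :
    0 ≤ weight φ D a :=
  integral_nonneg fun _ => sq_nonneg _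

lemma sum_weight_le_one (φ : K ≃ₗ[ZMod 2] (Fin n → ZMod 2)) (D : PMF (BoolPoly n)) :
    ∑ a, weight φ D a ≤ 1 := by
  simp only [weight]
  rw [← integral_finsetSum _ fun a _ => integrable_coordAmp_sq φ D a]
  refine (integral_mono (integrable_finsetSum _ fun a _ => integrable_coordAmp_sq φ D a)
    (integrable_const (1 : ℝ)) fun p => sum_coordAmp_sq_le_one φ p).trans ?_
  simp

/-- Distinct Fourier coefficients are uncorrelated under a shift-invariant distribution. -/
lemma integral_coordAmp_mul [DecidableEq K] (φ : K ≃ₗ[ZMod 2] (Fin n → ZMod 2))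
    {D : PMF (BoolPoly n)} (hD : ShiftInvariant D) (a b : K) :
    ∫ p, coordAmp φ a p * coordAmp φ b p ∂D.toMeasure = if a = b then weight φ D a else 0 := by
  split_ifs with h
  · simp only [weight, h, sq]
  have hab : a + b ≠ 0 := fun h0 =>
    h (add_right_cancel (h0.trans (add_self_eq_zero_of_algebra b).symm))
  -- Shifting by `φ t` multiplies the product of the two coefficients by the character at t(a + b),
  -- here -1, while the distribution is unchanged; the integral is therefore its own negative.
  obtain ⟨t, ht⟩ := exists_traceSign_eq_neg_one hab
  have h1 : ∫ p, coordAmp φ a p * coordAmp φ b p ∂D.toMeasure =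
      ∫ p, coordAmp φ a (shift (φ t) p) * coordAmp φ b (shift (φ t) p) ∂D.toMeasure := by
    conv_lhs => rw [← hD (φ t), ← PMF.toMeasure_map _ _ Measurable.of_discrete]
    exact integral_map Measurable.of_discrete.aemeasurable
      Measurable.of_discrete.aestronglyMeasurable
  have h2 (p : BoolPoly n) : coordAmp φ a (shift (φ t) p) * coordAmp φ b (shift (φ t) p) =
      -(coordAmp φ a p * coordAmp φ b p) := by
    rw [mul_add, AddChar.map_add_eq_mul] at ht
    rw [coordAmp_shift, coordAmp_shift]
    linear_combination (coordAmp φ a p * coordAmp φ b p) * ht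
  simp only [h2, integral_neg] at h1
  linarith

open Classical in
/-- The indicator of a zero at `x`. -/
noncomputable def zeroInd (φ : K ≃ₗ[ZMod 2] (Fin n → ZMod 2)) (x : K) (p : BoolPoly n) : ℝ :=
  if x ∈ zeros φ p then 1 else 0

lemma integrable_zeroInd (φ : K ≃ₗ[ZMod 2] (Fin n → ZMod 2)) (D : PMF (BoolPoly n)) (x : K) :
    Integrable (zeroInd φ x) D.toMeasure :=
  integrable_of_abs_le D 1 fun p => by unfold zeroInd; split_ifs <;> simp

lemma integral_joint (φ : K ≃ₗ[ZMod 2] (Fin n → ZMod 2)) {D : PMF (BoolPoly n)}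
    (hD : TwoWiseIndependent D) {x y : K} (hxy : x ≠ y) (a b : ZMod 2) :
    ∫ p, Set.indicator {p | MvPolynomial.eval (φ x) p = a ∧ MvPolynomial.eval (φ y) p = b}
      (fun _ => (1 : ℝ)) p ∂D.toMeasure = 1 / 4 := by
  rw [integral_indicator (MeasurableSet.of_discrete), setIntegral_const, measureReal_def,
    hD _ _ (φ.injective.ne hxy)]
  simp

lemma integral_zeroInd_mul (φ : K ≃ₗ[ZMod 2] (Fin n → ZMod 2)) {D : PMF (BoolPoly n)}
    (hD : TwoWiseIndependent D) {x y : K} (hxy : x ≠ y) :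
    ∫ p, zeroInd φ x p * zeroInd φ y p ∂D.toMeasure = 1 / 4 := by
  rw [← integral_joint φ hD hxy 0 0]
  congr 1
  funext p
  simp only [zeroInd, zeros, Finset.mem_filter_univ, Set.indicator_apply, Set.mem_ofPred_eq]
  split_ifs <;> simp_all

/-- The one-point marginal is obtained by summing the joint law over the two possible values at an
auxiliary second point. -/
lemma integral_zeroInd (φ : K ≃ₗ[ZMod 2] (Fin n → ZMod 2)) {D : PMF (BoolPoly n)}
    (hD : TwoWiseIndependent D) (x : K) : ∫ p, zeroInd φ x p ∂D.toMeasure = 1 / 2 := by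
  obtain ⟨y, hy⟩ := exists_ne x
  have h (p : BoolPoly n) : zeroInd φ x p =
      Set.indicator {p | MvPolynomial.eval (φ x) p = 0 ∧ MvPolynomial.eval (φ y) p = 0}
        (fun _ => (1 : ℝ)) p +
      Set.indicator {p | MvPolynomial.eval (φ x) p = 0 ∧ MvPolynomial.eval (φ y) p = 1}
        (fun _ => (1 : ℝ)) p := by
    have two (c : ZMod 2) : c = 0 ∨ c = 1 := by revert c; decide
    simp only [zeroInd, zeros, Finset.mem_filter_univ, Set.indicator_apply, Set.mem_ofPred_eq]
    rcases two (MvPolynomial.eval (φ y) p) with h | h <;> simp [h]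
  have hi (S : Set (BoolPoly n)) : Integrable (S.indicator fun _ => (1 : ℝ)) D.toMeasure :=
    (integrable_const _).indicator MeasurableSet.of_discrete
  simp_rw [h]
  rw [integral_add (hi _) (hi _), integral_joint φ hD hy.symm, integral_joint φ hD hy.symm]
  norm_num

lemma zeroInd_sub_half_sq (φ : K ≃ₗ[ZMod 2] (Fin n → ZMod 2)) (x : K) (p : BoolPoly n) :
    (zeroInd φ x p - 1 / 2) * (zeroInd φ x p - 1 / 2) = 1 / 4 := by
  unfold zeroInd; split_ifs <;> norm_num

lemma abs_zeroInd_sub_half (φ : K ≃ₗ[ZMod 2] (Fin n → ZMod 2)) (x : K) (p : BoolPoly n) :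
    |zeroInd φ x p - 1 / 2| ≤ 1 := by
  rw [← sq_le_one_iff_abs_le_one, sq, zeroInd_sub_half_sq]
  norm_num

lemma integral_zeroInd_sub_half_mul [DecidableEq K] (φ : K ≃ₗ[ZMod 2] (Fin n → ZMod 2))
    {D : PMF (BoolPoly n)} (hD : TwoWiseIndependent D) (x y : K) :
    ∫ p, (zeroInd φ x p - 1 / 2) * (zeroInd φ y p - 1 / 2) ∂D.toMeasure =
      if x = y then 1 / 4 else 0 := by
  split_ifs with h
  · subst h
    simp only [zeroInd_sub_half_sq]
    simp
  have e (p : BoolPoly n) : (zeroInd φ x p - 1 / 2) * (zeroInd φ y p - 1 / 2) =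
      zeroInd φ x p * zeroInd φ y p - 1 / 2 * zeroInd φ x p - 1 / 2 * zeroInd φ y p + 1 / 4 := by
    ring
  have hxy : Integrable (fun p => zeroInd φ x p * zeroInd φ y p) D.toMeasure :=
    integrable_of_abs_le D 1 fun p => by unfold zeroInd; split_ifs <;> simp
  have hx := (integrable_zeroInd φ D x).const_mul (1 / 2)
  have hy := (integrable_zeroInd φ D y).const_mul (1 / 2)
  simp_rw [e]
  have h1 : Integrable (fun p => zeroInd φ x p * zeroInd φ y p - 1 / 2 * zeroInd φ x p)
      D.toMeasure := hxy.sub hx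
  have h2 : Integrable (fun p => zeroInd φ x p * zeroInd φ y p - 1 / 2 * zeroInd φ x p -
      1 / 2 * zeroInd φ y p) D.toMeasure := h1.sub hy
  rw [integral_add h2 (integrable_const _), integral_sub h1 hy,
    integral_sub hxy hx, integral_const_mul, integral_const_mul, integral_zeroInd_mul φ hD h,
    integral_zeroInd φ hD, integral_zeroInd φ hD]
  simp
  norm_num

lemma card_zeros_eq_sum (φ : K ≃ₗ[ZMod 2] (Fin n → ZMod 2)) (p : BoolPoly n) :
    ((zeros φ p).card : ℝ) = ∑ x, zeroInd φ x p := by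
  simp [zeroInd]

lemma weight_zero (φ : K ≃ₗ[ZMod 2] (Fin n → ZMod 2)) {D : PMF (BoolPoly n)}
    (hD : TwoWiseIndependent D) : weight φ D 0 = 1 / 2 := by
  simp only [weight, coordAmp_zero_sq, card_zeros_eq_sum]
  rw [integral_div, integral_finsetSum _ fun x _ => integrable_zeroInd φ D x]
  simp_rw [integral_zeroInd φ hD]
  have : (0 : ℝ) < Fintype.card K := Nat.cast_pos.2 Fintype.card_pos
  simp

/-- Centering the indicators costs nothing, because a nontrivial character sums to zero. The
centered indicators are orthogonal, which makes the second moment computable. -/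
lemma sum_zeros_traceSign (φ : K ≃ₗ[ZMod 2] (Fin n → ZMod 2)) {a : K} (ha : a ≠ 0)
    (p : BoolPoly n) :
    ∑ x ∈ zeros φ p, traceSign K (x * a) = ∑ x, traceSign K (x * a) * (zeroInd φ x p - 1 / 2) := by
  classical
  have h0 := sum_traceSign_mul_mul a 0
  simp only [zero_mul, AddChar.map_zero_eq_one, mul_one, ha, if_false, mul_comm a] at h0
  simp_rw [mul_sub, Finset.sum_sub_distrib, ← Finset.sum_mul, h0, zeroInd]
  simp

/-- The squared amplitude is controlled by the fluctuations of two linear statistics. -/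
lemma coordAmp_sq_le_fluctuation (φ : K ≃ₗ[ZMod 2] (Fin n → ZMod 2)) {a : K} (ha : a ≠ 0)
    (p : BoolPoly n) :
    coordAmp φ a p ^ 2 ≤ 4 / (Fintype.card K : ℝ) ^ 2 *
      ((∑ x, traceSign K (x * a) * (zeroInd φ x p - 1 / 2)) ^ 2 +
        (∑ x, 1 * (zeroInd φ x p - 1 / 2)) ^ 2) := by
  have hq : (0 : ℝ) < Fintype.card K := Nat.cast_pos.2 Fintype.card_pos
  have hs : ∑ x, 1 * (zeroInd φ x p - 1 / 2) = (zeros φ p).card - Fintype.card K / 2 := by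
    simp only [one_mul, Finset.sum_sub_distrib, ← card_zeros_eq_sum]
    simp [div_eq_mul_inv]
  rw [hs, ← sum_zeros_traceSign φ ha]
  have h1 := coordAmp_sq_le φ a p
  have h2 := coordAmp_sq φ a p
  generalize ∑ x ∈ zeros φ p, traceSign K (x * a) = S at *
  generalize ((zeros φ p).card : ℝ) = R at *
  generalize (Fintype.card K : ℝ) = q at *
  -- With at least q/4 zeros the normalizing denominator is harmless and the character sum gives the
  -- bound. With fewer zeros the count itself deviates from q/2 by at least q/4, so the second
  -- statistic pays for the trivial bound R/q.
  rcases le_total (q / 4) R with h | h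
  · have hR : 0 < R := by linarith
    calc coordAmp φ a p ^ 2 = S ^ 2 / (q * R) := h2
      _ ≤ S ^ 2 / (q * (q / 4)) := by gcongr
      _ = 4 / q ^ 2 * (S ^ 2 + 0) := by field_simp; ring
      _ ≤ _ := by gcongr; positivity
  · calc coordAmp φ a p ^ 2 ≤ R / q := h1
      _ ≤ q / 4 / q := by gcongr
      _ = 4 / q ^ 2 * (0 + (q / 4) ^ 2) := by field_simp; ring
      _ ≤ _ := mul_le_mul_of_nonneg_left (add_le_add (sq_nonneg S) (by nlinarith))
        (by positivity)

/-- Each of the two fluctuations has second moment q/4, and 4/q² times their sum is 2/q. -/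
lemma weight_le (φ : K ≃ₗ[ZMod 2] (Fin n → ZMod 2)) {D : PMF (BoolPoly n)}
    (hD : TwoWiseIndependent D) {a : K} (ha : a ≠ 0) : weight φ D a ≤ 2 / Fintype.card K := by
  classical
  have hq : (0 : ℝ) < Fintype.card K := Nat.cast_pos.2 Fintype.card_pos
  have key (f : K → ℝ) := integral_sq_sum_of_orthogonal D.toMeasure f
    (fun x p => zeroInd φ x p - 1 / 2) (fun _ => 1 / 4)
    (fun x y => integrable_of_abs_le D 1 fun p => by
      rw [abs_mul]
      exact mul_le_one₀ (abs_zeroInd_sub_half φ x p) (abs_nonneg _) (abs_zeroInd_sub_half φ y p))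
    (integral_zeroInd_sub_half_mul φ hD)
  have h1 := key fun x => traceSign K (x * a)
  have h2 := key fun _ => 1
  refine (integral_mono (integrable_coordAmp_sq φ D a) ((h1.1.add h2.1).const_mul _)
    (coordAmp_sq_le_fluctuation φ ha)).trans ?_
  simp only [integral_const_mul, Pi.add_apply]
  rw [integral_add h1.1 h2.1, h1.2, h2.2]
  have h3 (x : K) : traceSign K (x * a) ^ 2 = 1 := by rw [sq, traceSign_mul_self]
  simp only [h3, one_pow, one_mul, Finset.sum_const, Finset.card_univ, nsmul_eq_mul]
  apply le_of_eq
  field_simp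
  norm_num

end OnePolynomial

/-! ### The expected bad mass -/

section System

variable {K : Type} [Field K] [Fintype K] [Algebra (ZMod 2) K] {m n : ℕ}

lemma badMass_eq (γ : Fin m → K) (k : ℕ) (ε : ℝ) (φ : K ≃ₗ[ZMod 2] (Fin n → ZMod 2))
    [DecidablePred (· ∈ goodErrors γ k ε)] (P : Fin m → BoolPoly n) :
    badMass γ k ε φ P = ∑ z : Fin m → K, (∑ e : Fin m → K,
      ((if e ∈ goodErrors γ k ε then 0 else
        realFourier (realUniform (dualCode (rsCode γ k) : Set (Fin m → K))) (z - e)) *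
        ∏ i, coordAmp φ (e i) (P i))) ^ 2 := by
  classical
  unfold badMass
  refine Finset.sum_congr rfl fun z _ => ?_
  rw [← sq_abs (∑ e : Fin m → K, _ * _), ← Real.norm_eq_abs, ← Complex.norm_real]
  congr 2
  rw [Finset.sum_filter, Fintype.sum_prod_type_right, Complex.ofReal_sum]
  refine Finset.sum_congr rfl fun e _ => ?_
  -- For fixed e and z the only admissible x is z - e; membership in the code can then be ignored
  -- because the transform of `ampV` vanishes elsewhere.
  rw [Finset.sum_eq_single (z - e) (fun x _ hx => if_neg fun h => hx (eq_sub_of_add_eq h.2))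
    (fun h => absurd (Finset.mem_univ _) h), sub_add_cancel, fourier_ampW, ampV,
    uniformAmplitude_eq, fourier_ofReal]
  by_cases hx : z - e ∈ rsCode γ k
  · by_cases he : e ∈ goodErrors γ k ε <;> simp [bad, hx, he]
  · rw [realFourier_dualCode_eq_zero hx]
    simp

/-- The expected bad mass is at most the expected mass of the errors that are not good. -/
lemma integral_badMass_le (γ : Fin m → K) (k : ℕ) (ε : ℝ)
    (φ : K ≃ₗ[ZMod 2] (Fin n → ZMod 2)) [DecidablePred (· ∈ goodErrors γ k ε)]
    (D : Fin m → PMF (BoolPoly n)) (hD : ∀ i, ShiftInvariant (D i)) :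
    Integrable (badMass γ k ε φ) (systemLaw D) ∧
      ∫ P, badMass γ k ε φ P ∂systemLaw D ≤
        ∑ e : Fin m → K, if e ∈ goodErrors γ k ε then 0 else ∏ i, weight φ (D i) (e i) := by
  classical
  set F := realFourier (realUniform (dualCode (rsCode γ k) : Set (Fin m → K))) with hF
  have hmul (e e' : Fin m → K) (P : Fin m → BoolPoly n) :
      (∏ i, coordAmp φ (e i) (P i)) * ∏ i, coordAmp φ (e' i) (P i) =
        ∏ i, coordAmp φ (e i) (P i) * coordAmp φ (e' i) (P i) := Finset.prod_mul_distrib.symm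
  have key (z : Fin m → K) := integral_sq_sum_of_orthogonal (systemLaw D)
    (fun e : Fin m → K => if e ∈ goodErrors γ k ε then 0 else F (z - e))
    (fun e P => ∏ i, coordAmp φ (e i) (P i)) (fun e => ∏ i, weight φ (D i) (e i))
    (fun e e' => by
      simp_rw [hmul]
      exact Integrable.fintype_prod fun i => integrable_coordAmp_mul φ (D i) (e i) (e' i))
    (fun e e' => by
      simp_rw [hmul]
      rw [systemLaw, integral_fintype_prod_eq_prod
        (fun i p => coordAmp φ (e i) p * coordAmp φ (e' i) p)]
      simp_rw [fun i => integral_coordAmp_mul φ (hD i) (e i) (e' i)]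
      split_ifs with h
      · simp [h]
      · obtain ⟨i, hi⟩ := Function.ne_iff.1 h
        exact Finset.prod_eq_zero (Finset.mem_univ i) (if_neg hi))
  have hb : badMass γ k ε φ = fun P => ∑ z : Fin m → K, (∑ e : Fin m → K,
      ((if e ∈ goodErrors γ k ε then 0 else F (z - e)) *
        ∏ i, coordAmp φ (e i) (P i))) ^ 2 := funext (badMass_eq γ k ε φ)
  rw [hb]
  refine ⟨integrable_finsetSum _ fun z _ => (key z).1, ?_⟩
  rw [integral_finsetSum _ fun z _ => (key z).1]
  simp_rw [fun z => (key z).2]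
  rw [Finset.sum_comm]
  refine Finset.sum_le_sum fun e _ => ?_
  split_ifs with he
  · simp
  · rw [← Finset.sum_mul]
    refine mul_le_of_le_one_left (Finset.prod_nonneg fun i _ => weight_nonneg φ (D i) (e i)) ?_
    refine (Equiv.sum_comp (Equiv.subRight e) fun z => F z ^ 2).trans_le ?_
    rw [hF, sum_realFourier_sq]
    exact sum_realUniform_sq_le_one _

end System

/-! ### Tail bounds for product weights -/

section Tails

variable {K : Type} {m : ℕ}

/-- The exponential moment bound for the number of coordinates with a given property. -/
lemma sum_tail_le [Fintype K] (w : Fin m → K → ℝ) (hw : ∀ i a, 0 ≤ w i a)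
    (p : Fin m → K → Prop) [∀ i a, Decidable (p i a)] {θ : ℝ} (hθ : 1 ≤ θ) (r : ℝ) :
    (∑ e : Fin m → K, if r ≤ (Finset.univ.filter fun i => p i (e i)).card
      then ∏ i, w i (e i) else 0) ≤
      θ ^ (-r) * ∏ i, ∑ a, w i a * (if p i a then θ else 1) := by
  classical
  have hθ0 : 0 < θ := one_pos.trans_le hθ
  rw [Finset.prod_univ_sum, Fintype.piFinset_univ, Finset.mul_sum]
  refine Finset.sum_le_sum fun e _ => ?_
  have hP : 0 ≤ ∏ i, w i (e i) := Finset.prod_nonneg fun i _ => hw i (e i)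
  have h : ∏ i, w i (e i) * (if p i (e i) then θ else 1) =
      (∏ i, w i (e i)) * θ ^ (Finset.univ.filter fun i => p i (e i)).card := by
    rw [Finset.prod_mul_distrib, ← Finset.prod_filter, Finset.prod_const]
  rw [h]
  split_ifs with hr
  · have h1 : 1 ≤ θ ^ (-r) * θ ^ (Finset.univ.filter fun i => p i (e i)).card := by
      rw [← Real.rpow_natCast, ← Real.rpow_add hθ0]
      exact Real.one_le_rpow hθ (by linarith)
    calc ∏ i, w i (e i) = (∏ i, w i (e i)) * 1 := (mul_one _).symm
      _ ≤ (∏ i, w i (e i)) *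
          (θ ^ (-r) * θ ^ (Finset.univ.filter fun i => p i (e i)).card) := by gcongr
      _ = _ := by ring
  · positivity

/-- Hoeffding's bound for a fair bit: factoring out the mean leaves a hyperbolic cosine, which is
sub-Gaussian. -/
lemma half_one_add_exp_le (s : ℝ) : (1 + Real.exp s) / 2 ≤ Real.exp (s / 2 + s ^ 2 / 8) := by
  have h : (1 + Real.exp s) / 2 = Real.exp (s / 2) * Real.cosh (s / 2) := by
    rw [Real.cosh_eq, mul_div_assoc', mul_add, ← Real.exp_add, ← Real.exp_add, add_halves,
      add_neg_cancel, Real.exp_zero, add_comm]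
  rw [h, Real.exp_add]
  gcongr
  refine (Real.cosh_le_exp_half_sq _).trans_eq ?_
  congr 1
  ring

variable [Field K] [Fintype K] [DecidableEq K]

/-- Heavy errors are rare. -/
lemma sum_heavy_le (w : Fin m → K → ℝ) (hw : ∀ i a, 0 ≤ w i a) (h0 : ∀ i, w i 0 = 1 / 2)
    (h1 : ∀ i, ∑ a, w i a ≤ 1) {ε : ℝ} (hε : 0 ≤ ε) :
    (∑ e : Fin m → K, if (1 / 2 + ε) * m ≤ (Finset.univ.filter fun i => e i ≠ 0).card
      then ∏ i, w i (e i) else 0) ≤ Real.exp (-(2 * ε ^ 2 * m)) := by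
  -- With tilt `exp s` the exponent per coordinate is s²/8 - sε, minimized at s = 4ε with value
  -- -2ε².
  have hθ : 1 ≤ Real.exp (4 * ε) := Real.one_le_exp (by positivity)
  refine (sum_tail_le w hw (fun _ a => a ≠ 0) hθ _).trans ?_
  have h (i : Fin m) : ∑ a, w i a * (if a ≠ 0 then Real.exp (4 * ε) else 1) ≤
      Real.exp (4 * ε / 2 + (4 * ε) ^ 2 / 8) := by
    refine le_trans ?_ (half_one_add_exp_le _)
    have e := Finset.add_sum_erase Finset.univ (w i) (Finset.mem_univ 0)
    rw [← Finset.add_sum_erase _ _ (Finset.mem_univ (0 : K))]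
    have e2 : ∑ a ∈ Finset.univ.erase (0 : K), w i a * (if a ≠ 0 then Real.exp (4 * ε) else 1) =
        (∑ a ∈ Finset.univ.erase (0 : K), w i a) * Real.exp (4 * ε) := by
      rw [Finset.sum_mul]
      exact Finset.sum_congr rfl fun a ha => by rw [if_pos (Finset.ne_of_mem_erase ha)]
    rw [e2]
    simp only [h0, ne_eq, not_true_eq_false, if_false, mul_one] at e ⊢
    have := h1 i
    nlinarith
  have hp : ∏ i, ∑ a, w i a * (if a ≠ 0 then Real.exp (4 * ε) else 1) ≤
      Real.exp (4 * ε / 2 + (4 * ε) ^ 2 / 8) ^ m := by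
    refine (Finset.prod_le_prod (fun i _ => Finset.sum_nonneg fun a _ =>
      mul_nonneg (hw i a) (by split_ifs <;> positivity)) fun i _ => h i).trans ?_
    simp
  refine (mul_le_mul_of_nonneg_left hp (by positivity)).trans_eq ?_
  rw [← Real.exp_mul, ← Real.exp_nat_mul, ← Real.exp_add]
  congr 1
  ring

/-- Errors that agree with a fixed vector with few zeros in many places are rare. -/
lemma sum_agree_le (w : Fin m → K → ℝ) (hw : ∀ i a, 0 ≤ w i a) (h0 : ∀ i, w i 0 = 1 / 2)
    (h1 : ∀ i, ∑ a, w i a ≤ 1) (h2 : ∀ i a, a ≠ 0 → w i a ≤ 2 / Fintype.card K)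
    (c : Fin m → K) {k : ℕ} (hc : (Finset.univ.filter fun i => c i = 0).card ≤ k) (r : ℝ) :
    (∑ e : Fin m → K, if r ≤ (Finset.univ.filter fun i => e i = c i).card
      then ∏ i, w i (e i) else 0) ≤
      (Fintype.card K : ℝ) ^ (-r) * (3 ^ m * (Fintype.card K : ℝ) ^ k) := by
  have hq : (1 : ℝ) ≤ Fintype.card K := Nat.one_le_cast.2 Fintype.card_pos
  -- Tilting by q balances the bound 2/q: a coordinate with `c i ≠ 0` has moment at most 1 + 2. Only
  -- the at most k coordinates with `c i = 0`, where the weight is 1/2, cost a factor of order q.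
  refine (sum_tail_le w hw (fun i a => a = c i) hq r).trans ?_
  gcongr
  have h (i : Fin m) : ∑ a, w i a * (if a = c i then (Fintype.card K : ℝ) else 1) ≤
      3 * (if c i = 0 then (Fintype.card K : ℝ) else 1) := by
    have e : ∑ a, w i a * (if a = c i then (Fintype.card K : ℝ) else 1) =
        ∑ a, w i a + w i (c i) * (Fintype.card K - 1) := by
      have (a : K) : w i a * (if a = c i then (Fintype.card K : ℝ) else 1) =
          w i a + if a = c i then w i a * (Fintype.card K - 1) else 0 := by
        split_ifs <;> ring
      simp_rw [this, Finset.sum_add_distrib]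
      simp
    rw [e]
    have := h1 i
    split_ifs with hci
    · rw [hci, h0]
      linarith
    · have h3 := h2 i _ hci
      rw [le_div_iff₀ (by linarith)] at h3
      have := hw i (c i)
      linarith
  calc ∏ i, ∑ a, w i a * (if a = c i then (Fintype.card K : ℝ) else 1)
      ≤ ∏ i, 3 * (if c i = 0 then (Fintype.card K : ℝ) else 1) :=
        Finset.prod_le_prod (fun i _ => Finset.sum_nonneg fun a _ =>
          mul_nonneg (hw i a) (by split_ifs <;> linarith)) fun i _ => h i
    _ = 3 ^ m * (Fintype.card K : ℝ) ^ (Finset.univ.filter fun i => c i = 0).card := by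
        rw [Finset.prod_mul_distrib, ← Finset.prod_filter, Finset.prod_const, Finset.prod_const]
        simp
    _ ≤ _ := by gcongr

end Tails

/-! ### Reed-Solomon codewords and decoding -/

section ReedSolomon

variable {K : Type} [Field K] {m : ℕ}

lemma card_zeros_le_of_mem_rsCode [DecidableEq K] {γ : Fin m → K} (hγ : Function.Injective γ)
    {k : ℕ} {c : Fin m → K} (hc : c ∈ rsCode γ k) (hc0 : c ≠ 0) :
    (Finset.univ.filter fun i => c i = 0).card ≤ k := by
  obtain ⟨f, hf, rfl⟩ := hc
  have hf0 : f ≠ 0 := by rintro rfl; exact hc0 (map_zero _)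
  have hdeg : f.natDegree < k :=
    (Polynomial.natDegree_lt_iff_degree_lt hf0).2 (Polynomial.mem_degreeLT.1 hf)
  calc _ = ((Finset.univ.filter fun i =>
        (LinearMap.pi fun i => Polynomial.leval (γ i)) f i = 0).map ⟨γ, hγ⟩).card :=
        (Finset.card_map _).symm
    _ ≤ f.roots.toFinset.card := by
        refine Finset.card_le_card fun a ha => ?_
        obtain ⟨i, hi, rfl⟩ := Finset.mem_map.1 ha
        simp only [Finset.mem_filter_univ, LinearMap.pi_apply, Polynomial.leval_apply] at hi
        simpa [hf0] using hi
    _ ≤ f.roots.card := f.roots.toFinset_card_le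
    _ ≤ f.natDegree := f.card_roots'
    _ ≤ k := hdeg.le

lemma card_rsCode_le [Fintype K] (γ : Fin m → K) (k : ℕ)
    [DecidablePred (· ∈ rsCode γ k)] :
    (Finset.univ.filter (· ∈ rsCode γ k)).card ≤ Fintype.card K ^ k := by
  classical
  calc _ ≤ (Finset.univ.image fun v : Fin k → K => fun i =>
        Polynomial.eval (γ i) ((Polynomial.degreeLTEquiv K k).symm v : Polynomial K)).card := by
        refine Finset.card_le_card fun c hc => ?_
        obtain ⟨f, hf, rfl⟩ := (Finset.mem_filter_univ c).1 hc
        refine Finset.mem_image.2 ⟨Polynomial.degreeLTEquiv K k ⟨f, hf⟩, Finset.mem_univ _, ?_⟩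
        rw [LinearEquiv.symm_apply_apply]
        rfl
    _ ≤ Fintype.card (Fin k → K) := Finset.card_image_le
    _ = _ := by simp

open Classical in
lemma agree_card_add_hammingNorm_sub (e c : Fin m → K) :
    (Finset.univ.filter fun i => e i = c i).card + hammingNorm (e - c) = m := by
  have h := Finset.card_filter_add_card_filter_not (s := (Finset.univ : Finset (Fin m)))
    fun i => e i = c i
  simp only [Finset.card_univ, Fintype.card_fin] at h
  simpa [hammingNorm, sub_eq_zero] using h

open Classical in
/-- An error is good unless it is heavy or close to a nonzero codeword. -/
lemma heavy_or_agree_of_notMem_goodErrors {γ : Fin m → K} {k : ℕ} {ε : ℝ}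
    (hk : √((k : ℝ) * m) ≤ (1 / 2 - ε) * m) {e : Fin m → K} (he : e ∉ goodErrors γ k ε) :
    (1 / 2 + ε) * m ≤ (Finset.univ.filter fun i => e i ≠ 0).card ∨
      ∃ c ∈ rsCode γ k, c ≠ 0 ∧
        (1 / 2 - ε) * m ≤ (Finset.univ.filter fun i => e i = c i).card := by
  by_contra! h
  obtain ⟨hl, ha⟩ := h
  refine he fun x hx => ?_
  have hn : (hammingNorm e : ℝ) < (1 / 2 + ε) * m := hl
  have hx1 : x ∈ listDecode γ k (x + e) ∧ (hammingNorm (x + e - x) : ℝ) ≤ (1 / 2 + ε) * m := by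
    refine ⟨⟨hx, ?_⟩, ?_⟩
    · have h1 : hammingNorm (x - (x + e)) = hammingNorm e := by
        rw [sub_add_cancel_left]
        simp [hammingNorm]
      rw [h1]
      linarith
    · rw [add_sub_cancel_left]
      exact hn.le
  have huniq (y : Fin m → K) (hy : y ∈ listDecode γ k (x + e) ∧
      (hammingNorm (x + e - y) : ℝ) ≤ (1 / 2 + ε) * m) : y = x := by
    by_contra hne
    -- A second candidate y would make e agree with the nonzero codeword y - x in at least (1/2 -
    -- ε)m places, which `ha` forbids.
    have h1 := ha (y - x) (sub_mem hy.1.1 hx) (sub_ne_zero.2 hne)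
    have h2 : (((Finset.univ.filter fun i => e i = (y - x) i).card +
      hammingNorm (e - (y - x)) : ℕ) : ℝ) = m := by rw [agree_card_add_hammingNorm_sub]
    rw [show e - (y - x) = x + e - y by abel] at h2
    push_cast at h2
    linarith [hy.2]
  have hex : ∃! x', x' ∈ listDecode γ k (x + e) ∧
      (hammingNorm (x + e - x') : ℝ) ≤ (1 / 2 + ε) * m := ⟨x, hx1, huniq⟩
  rw [decode, dif_pos hex]
  exact huniq _ hex.choose_spec.1

/-- The mass of the errors that are not good, for near-uniform product weights. -/
lemma sum_notMem_goodErrors_le [Fintype K] {γ : Fin m → K} (hγ : Function.Injective γ) {k : ℕ}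
    {ε : ℝ} (hε : 0 ≤ ε) (hk : √((k : ℝ) * m) ≤ (1 / 2 - ε) * m)
    [DecidablePred (· ∈ goodErrors γ k ε)]
    (w : Fin m → K → ℝ) (hw : ∀ i a, 0 ≤ w i a) (h0 : ∀ i, w i 0 = 1 / 2)
    (h1 : ∀ i, ∑ a, w i a ≤ 1) (h2 : ∀ i a, a ≠ 0 → w i a ≤ 2 / Fintype.card K) :
    (∑ e : Fin m → K, if e ∈ goodErrors γ k ε then 0 else ∏ i, w i (e i)) ≤
      Real.exp (-(2 * ε ^ 2 * m)) + (Fintype.card K : ℝ) ^ k *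
        ((Fintype.card K : ℝ) ^ (-((1 / 2 - ε) * m)) * (3 ^ m * (Fintype.card K : ℝ) ^ k)) := by
  classical
  have hP (e : Fin m → K) : 0 ≤ ∏ i, w i (e i) := Finset.prod_nonneg fun i _ => hw i (e i)
  set S := Finset.univ.filter fun c : Fin m → K => c ∈ rsCode γ k ∧ c ≠ 0
  have hS : (S.card : ℝ) ≤ (Fintype.card K : ℝ) ^ k := by
    have : S.card ≤ Fintype.card K ^ k := (Finset.card_le_card fun c hc => by
      simp only [S, Finset.mem_filter_univ] at hc ⊢
      exact hc.1).trans (card_rsCode_le γ k)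
    exact_mod_cast this
  have hstep : (∑ e : Fin m → K, if e ∈ goodErrors γ k ε then 0 else ∏ i, w i (e i)) ≤
      (∑ e : Fin m → K, if (1 / 2 + ε) * m ≤ (Finset.univ.filter fun i => e i ≠ 0).card
        then ∏ i, w i (e i) else 0) +
      ∑ c ∈ S, ∑ e : Fin m → K,
        if (1 / 2 - ε) * m ≤ (Finset.univ.filter fun i => e i = c i).card
          then ∏ i, w i (e i) else 0 := by
    rw [Finset.sum_comm, ← Finset.sum_add_distrib]
    refine Finset.sum_le_sum fun e _ => ?_
    have hheavy : 0 ≤ if (1 / 2 + ε) * m ≤ (Finset.univ.filter fun i => e i ≠ 0).card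
        then ∏ i, w i (e i) else 0 := by split_ifs <;> simp [hP]
    have hagree (c : Fin m → K) :
        0 ≤ if (1 / 2 - ε) * m ≤ (Finset.univ.filter fun i => e i = c i).card
          then ∏ i, w i (e i) else 0 := by split_ifs <;> simp [hP]
    have hsum := Finset.sum_nonneg fun c (_ : c ∈ S) => hagree c
    by_cases he : e ∈ goodErrors γ k ε
    · rw [if_pos he]
      exact add_nonneg hheavy hsum
    rw [if_neg he]
    rcases heavy_or_agree_of_notMem_goodErrors hk he with h | ⟨c, hc, hc0, h⟩
    · rw [if_pos (by convert h)]
      exact le_add_of_nonneg_right hsum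
    · refine le_trans ?_ (le_add_of_nonneg_left hheavy)
      refine le_trans ?_ (Finset.single_le_sum (fun c _ => hagree c)
        ((Finset.mem_filter_univ c).2 ⟨hc, hc0⟩))
      rw [if_pos (by convert h)]
  refine hstep.trans (add_le_add (sum_heavy_le w hw h0 h1 hε) ?_)
  refine (Finset.sum_le_card_nsmul S _ ((Fintype.card K : ℝ) ^ (-((1 / 2 - ε) * m)) *
    (3 ^ m * (Fintype.card K : ℝ) ^ k)) fun c hc => ?_).trans ?_
  · simp only [S, Finset.mem_filter_univ] at hc
    exact sum_agree_le w hw h0 h1 h2 c (card_zeros_le_of_mem_rsCode hγ hc.1 hc.2) _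
  · rw [nsmul_eq_mul]
    gcongr

end ReedSolomon

/-! ### The bound for fixed parameters -/

section Parameters

/-- This puts the decoding radius (1/2 + ε)m within the list radius. The slack (1/2 - ε)² - (1/8 -
3ε/4) is at least 1/12 for ε < 1/6, so m ≥ 16 absorbs the rounding of k. -/
lemma sqrt_mul_le_of_rate {m k : ℕ} {ε α : ℝ} (hε₁ : ε < 1 / 6)
    (hα₀ : 7 / 8 + 3 / 4 * ε < α) (hm : 16 ≤ m) (hk : |(k : ℝ) - (1 - α) * m| < 1) :
    √((k : ℝ) * m) ≤ (1 / 2 - ε) * m := by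
  have hm' : (16 : ℝ) ≤ m := by exact_mod_cast hm
  have h1 := (abs_lt.1 hk).2
  have h2 : (1 - α) * m ≤ (1 / 8 - 3 / 4 * ε) * m :=
    mul_le_mul_of_nonneg_right (by linarith) (by linarith)
  have h3 : 1 / 12 * (m : ℝ) ≤ (1 / 8 - ε / 4 + ε ^ 2) * m := by
    gcongr
    nlinarith [sq_nonneg ε]
  refine Real.sqrt_le_iff.2 ⟨mul_nonneg (by linarith) (by linarith), ?_⟩
  have h4 : (k : ℝ) ≤ (1 / 2 - ε) ^ 2 * m := by linarith
  calc (k : ℝ) * m ≤ (1 / 2 - ε) ^ 2 * m * m := by gcongr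
    _ = _ := by ring

/-- The total exponent of q is 2k - (1/2 - ε)m, below 2 - m/4 and hence at most -m/8 once m ≥ 16.
For q ≥ 2^32 this gives 16^(-m), which beats 3^m since 3/16 < 1/e. -/
lemma agree_bound_le {n m k : ℕ} {q ε α : ℝ} (hε₀ : 0 < ε) (hα₀ : 7 / 8 + 3 / 4 * ε < α)
    (hm : 16 ≤ m) (hn : 32 ≤ n) (hq : q = 2 ^ n) (hk : |(k : ℝ) - (1 - α) * m| < 1) :
    q ^ k * (q ^ (-((1 / 2 - ε) * m)) * (3 ^ m * q ^ k)) ≤ Real.exp (-(m : ℝ)) := by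
  have hm' : (16 : ℝ) ≤ m := by exact_mod_cast hm
  have hq32 : (2 : ℝ) ^ 32 ≤ q := hq ▸ pow_le_pow_right₀ (by norm_num) hn
  have hq1 : 1 ≤ q := le_trans (by norm_num) hq32
  have hq0 : 0 < q := by linarith
  have h1 := (abs_lt.1 hk).2
  have h2 : (1 - α) * m ≤ (1 / 8 - 3 / 4 * ε) * m :=
    mul_le_mul_of_nonneg_right (by linarith) (by linarith)
  have h3 : 0 ≤ ε * m := by positivity
  calc q ^ k * (q ^ (-((1 / 2 - ε) * m)) * (3 ^ m * q ^ k))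
      = 3 ^ m * q ^ ((k : ℝ) + -((1 / 2 - ε) * m) + k) := by
        rw [Real.rpow_add hq0, Real.rpow_add hq0, Real.rpow_natCast]
        ring
    _ ≤ 3 ^ m * q ^ (-(m / 8 : ℝ)) := by
        gcongr 3 ^ m * ?_
        exact Real.rpow_le_rpow_of_exponent_le hq1 (by linarith)
    _ ≤ 3 ^ m * ((2 : ℝ) ^ 32) ^ (-(m / 8 : ℝ)) := by
        gcongr 3 ^ m * ?_
        exact Real.rpow_le_rpow_of_nonpos (by norm_num) hq32 (by linarith)
    _ = (3 / 16) ^ m := by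
        have h : ((2 : ℝ) ^ 32) ^ (-(m / 8 : ℝ)) = (16 ^ m)⁻¹ := by
          rw [← Real.rpow_natCast 2 32, ← Real.rpow_mul (by norm_num), ← Real.rpow_natCast 16 m,
            ← Real.rpow_neg (by norm_num), show (16 : ℝ) = 2 ^ (4 : ℝ) by norm_num,
            ← Real.rpow_mul (by norm_num)]
          congr 1
          push_cast
          ring
        rw [h, div_pow, div_eq_mul_inv]
    _ ≤ Real.exp (-1) ^ m := by
        gcongr
        rw [Real.exp_neg]
        refine (le_inv_comm₀ (by norm_num) (Real.exp_pos 1)).2 ?_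
        have := Real.exp_one_lt_d9
        norm_num
        linarith
    _ = Real.exp (-(m : ℝ)) := by rw [← Real.exp_nat_mul]; simp

variable {K : Type} [Field K] [Fintype K] [Algebra (ZMod 2) K] {m n : ℕ}

lemma integral_badMass_le_exp {ε α : ℝ} (hε₀ : 0 < ε) (hε₁ : ε < 1 / 6)
    (hα₀ : 7 / 8 + 3 / 4 * ε < α) (hm : 16 ≤ m) (hn : 32 ≤ n)
    (φ : K ≃ₗ[ZMod 2] (Fin n → ZMod 2)) {γ : Fin m → K} (hγ : Function.Injective γ) {k : ℕ}
    (hk : |(k : ℝ) - (1 - α) * m| < 1) {D : Fin m → PMF (BoolPoly n)}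
    (hs : ∀ i, ShiftInvariant (D i)) (h2 : ∀ i, TwoWiseIndependent (D i)) :
    ∫ P, badMass γ k ε φ P ∂systemLaw D ≤ 2 * Real.exp (-(ε ^ 2 * m)) ^ 2 := by
  classical
  have hcard : (Fintype.card K : ℝ) = 2 ^ n := by
    rw [Fintype.card_congr φ.toEquiv]; simp
  refine (integral_badMass_le γ k ε φ D hs).2.trans
    ((sum_notMem_goodErrors_le hγ hε₀.le (sqrt_mul_le_of_rate hε₁ hα₀ hm hk)
      (fun i => weight φ (D i)) (fun i => weight_nonneg φ (D i)) (fun i => weight_zero φ (h2 i))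
      (fun i => sum_weight_le_one φ (D i)) fun i a => weight_le φ (h2 i)).trans ?_)
  have h3 := agree_bound_le hε₀ hα₀ hm hn hcard hk
  have h4 : Real.exp (-(m : ℝ)) ≤ Real.exp (-(2 * ε ^ 2 * m)) := by
    gcongr
    exact mul_le_of_le_one_left (Nat.cast_nonneg m) (by nlinarith)
  have h5 : Real.exp (-(ε ^ 2 * m)) ^ 2 = Real.exp (-(2 * ε ^ 2 * m)) := by
    rw [← Real.exp_nat_mul]
    congr 1
    push_cast
    ring
  rw [h5]
  linarith

lemma one_sub_le_measureReal_badMass_le {ε α : ℝ} (hε₀ : 0 < ε) (hε₁ : ε < 1 / 6)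
    (hα₀ : 7 / 8 + 3 / 4 * ε < α) (hm : 16 ≤ m) (hn : 32 ≤ n)
    (φ : K ≃ₗ[ZMod 2] (Fin n → ZMod 2)) {γ : Fin m → K} (hγ : Function.Injective γ) {k : ℕ}
    (hk : |(k : ℝ) - (1 - α) * m| < 1) {D : Fin m → PMF (BoolPoly n)}
    (hs : ∀ i, ShiftInvariant (D i)) (h2 : ∀ i, TwoWiseIndependent (D i)) :
    1 - Real.exp (-(ε ^ 2 * m)) ≤
      (systemLaw D).real {P | badMass γ k ε φ P ≤ 2 * Real.exp (-(ε ^ 2 * m))} := by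
  classical
  have : IsProbabilityMeasure (systemLaw D) := by unfold systemLaw; infer_instance
  set t := Real.exp (-(ε ^ 2 * m)) with ht
  have ht0 : 0 < t := Real.exp_pos _
  -- The mean is at most 2t², so Markov at level 2t leaves failure probability at most t.
  have hM := mul_meas_ge_le_integral_of_nonneg
    (ae_of_all _ fun P => Finset.sum_nonneg fun z _ => sq_nonneg _)
    (integral_badMass_le γ k ε φ D hs).1 (2 * t)
  have hE := hM.trans (integral_badMass_le_exp hε₀ hε₁ hα₀ hm hn φ hγ hk hs h2)
  have hM2 : (systemLaw D).real {P | 2 * t ≤ badMass γ k ε φ P} ≤ t := by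
    refine le_of_mul_le_mul_left (hE.trans_eq ?_) (by positivity : 0 < 2 * t)
    ring
  have hU : (1 : ℝ) ≤ (systemLaw D).real {P | badMass γ k ε φ P ≤ 2 * t} +
      (systemLaw D).real {P | 2 * t ≤ badMass γ k ε φ P} := by
    refine le_trans (le_of_eq ?_) (measureReal_union_le _ _)
    rw [← probReal_univ (μ := systemLaw D)]
    congr 1
    ext P
    simp [le_total]
  linarith

end Parameters

/-! ### Negligible functions -/

section Asymptotic

lemma negligible_of_eventually_le {f : ℕ → ℝ} (hf : ∀ N, 0 ≤ f N)
    (h : ∀ c : ℕ, ∃ B : ℝ, ∀ᶠ N : ℕ in atTop, (N : ℝ) ^ c * f N ≤ B) : Negligible f := by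
  refine (superpolynomialDecay_iff_abs_isBoundedUnder f tendsto_natCast_atTop_atTop).2 fun c => ?_
  obtain ⟨B, hB⟩ := h c
  refine ⟨B, eventually_map.2 (hB.mono fun N hN => ?_)⟩
  rwa [abs_of_nonneg (mul_nonneg (by positivity) (hf N))]

variable {n m : ℕ → ℕ}

lemma eventually_le_of_isTheta (hn : (fun l : ℕ => (n l : ℝ)) =Θ[atTop] (fun l : ℕ => (l : ℝ))) :
    ∃ C : ℝ, 0 < C ∧ ∀ᶠ l : ℕ in atTop, (l : ℝ) ≤ C * n l := by
  obtain ⟨C, hC, h⟩ := hn.2.exists_pos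
  exact ⟨C, hC, h.bound.mono fun l hl => by simpa using hl⟩

lemma eventually_ge_of_isTheta (hn : (fun l : ℕ => (n l : ℝ)) =Θ[atTop] (fun l : ℕ => (l : ℝ)))
    (A : ℝ) : ∀ᶠ l : ℕ in atTop, A ≤ n l := by
  obtain ⟨C, hC, h⟩ := eventually_le_of_isTheta hn
  filter_upwards [h, tendsto_natCast_atTop_atTop.eventually_ge_atTop (C * A)] with l h1 h2
  exact le_of_mul_le_mul_left (h2.trans h1) hC

lemma eventually_ge_of_log_isLittleO
    (hn : (fun l : ℕ => (n l : ℝ)) =Θ[atTop] (fun l : ℕ => (l : ℝ)))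
    (hm : (fun l : ℕ => Real.log (n l)) =o[atTop] (fun l : ℕ => (m l : ℝ))) (A : ℝ) :
    ∀ᶠ l : ℕ in atTop, A ≤ m l := by
  filter_upwards [hm.def one_pos, eventually_ge_of_isTheta hn (Real.exp A)] with l h1 h2
  have h3 : A ≤ Real.log (n l) := (Real.le_log_iff_exp_le ((Real.exp_pos A).trans_le h2)).2 h2
  simp only [Real.norm_eq_abs, one_mul, Nat.abs_cast] at h1
  exact h3.trans ((le_abs_self _).trans h1)

/-- The condition log n = o(m) gives c log n ≤ ρm eventually; dividing ρ by c + 1 instead of c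
covers c = 0. -/
lemma eventually_pow_mul_exp_le_one
    (hn : (fun l : ℕ => (n l : ℝ)) =Θ[atTop] (fun l : ℕ => (l : ℝ)))
    (hm : (fun l : ℕ => Real.log (n l)) =o[atTop] (fun l : ℕ => (m l : ℝ))) {ρ : ℝ}
    (hρ : 0 < ρ) (c : ℕ) :
    ∀ᶠ l : ℕ in atTop, (n l : ℝ) ^ c * Real.exp (-(ρ * m l)) ≤ 1 := by
  have hc : (0 : ℝ) < c + 1 := by positivity
  filter_upwards [hm.def (div_pos hρ hc), eventually_ge_of_isTheta hn 1] with l h1 h2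
  have h0 : (0 : ℝ) < n l := by linarith
  have hlog : 0 ≤ Real.log (n l) := Real.log_nonneg h2
  simp only [Real.norm_eq_abs, Nat.abs_cast, abs_of_nonneg hlog, div_mul_eq_mul_div] at h1
  rw [le_div_iff₀ hc] at h1
  rw [← Real.exp_log h0, ← Real.exp_nat_mul, ← Real.exp_add, Real.exp_le_one_iff]
  linarith

lemma negligible_exp (hn : (fun l : ℕ => (n l : ℝ)) =Θ[atTop] (fun l : ℕ => (l : ℝ)))
    (hm : (fun l : ℕ => Real.log (n l)) =o[atTop] (fun l : ℕ => (m l : ℝ))) {ρ : ℝ}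
    (hρ : 0 < ρ) : Negligible fun l => min 1 (2 * Real.exp (-(ρ * m l))) := by
  refine negligible_of_eventually_le (fun l => by positivity) fun c => ?_
  obtain ⟨C, hC, h⟩ := eventually_le_of_isTheta hn
  refine ⟨2 * C ^ c, ?_⟩
  filter_upwards [h, eventually_pow_mul_exp_le_one hn hm hρ c] with l h1 h2
  calc (l : ℝ) ^ c * min 1 (2 * Real.exp (-(ρ * m l)))
      ≤ (C * n l) ^ c * (2 * Real.exp (-(ρ * m l))) := by
        gcongr
        exact min_le_right _ _
    _ = 2 * C ^ c * ((n l : ℝ) ^ c * Real.exp (-(ρ * m l))) := by ring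
    _ ≤ 2 * C ^ c * 1 := by gcongr
    _ = _ := mul_one _

/-- The worst value of `exp (-ρ m)` among the parameters with a given `n`. -/
noncomputable def fiberSup (n m : ℕ → ℕ) (ρ : ℝ) (N : ℕ) : ℝ :=
  ⨆ l : {l // n l = N}, Real.exp (-(ρ * m l))

lemma exp_neg_mul_natCast_le_one {ρ : ℝ} (hρ : 0 < ρ) (j : ℕ) : Real.exp (-(ρ * j)) ≤ 1 :=
  Real.exp_le_one_iff.2 (neg_nonpos.2 (by positivity))

lemma fiberSup_nonneg (n m : ℕ → ℕ) (ρ : ℝ) (N : ℕ) : 0 ≤ fiberSup n m ρ N :=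
  Real.iSup_nonneg fun _ => (Real.exp_pos _).le

lemma fiberSup_le_one {ρ : ℝ} (hρ : 0 < ρ) (N : ℕ) : fiberSup n m ρ N ≤ 1 :=
  Real.iSup_le (fun l => exp_neg_mul_natCast_le_one hρ (m l)) zero_le_one

lemma le_fiberSup {ρ : ℝ} (hρ : 0 < ρ) (l : ℕ) :
    Real.exp (-(ρ * m l)) ≤ fiberSup n m ρ (n l) :=
  le_ciSup (f := fun l' : {l' // n l' = n l} => Real.exp (-(ρ * m l')))
    ⟨1, by rintro _ ⟨l', rfl⟩; exact exp_neg_mul_natCast_le_one hρ (m l')⟩ ⟨l, rfl⟩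

/-- The failure bound must be a function of n(λ), and several λ may share one value, hence the
supremum over fibers. The finitely many λ below the threshold L have bounded n, so the fiber over a
large N avoids them; an empty fiber has supremum 0. -/
lemma negligible_fiberSup (hn : (fun l : ℕ => (n l : ℝ)) =Θ[atTop] (fun l : ℕ => (l : ℝ)))
    (hm : (fun l : ℕ => Real.log (n l)) =o[atTop] (fun l : ℕ => (m l : ℝ))) {ρ : ℝ}
    (hρ : 0 < ρ) : Negligible (fiberSup n m ρ) := by
  refine negligible_of_eventually_le (fiberSup_nonneg n m ρ) fun c => ⟨1, ?_⟩
  obtain ⟨L, hL⟩ := eventually_atTop.1 (eventually_pow_mul_exp_le_one hn hm hρ c)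
  filter_upwards [eventually_gt_atTop ((Finset.range L).sup n), eventually_gt_atTop 0]
    with N hN hN0
  have hNc : (0 : ℝ) < (N : ℝ) ^ c := by positivity
  rw [mul_comm, ← le_div_iff₀ hNc]
  refine Real.iSup_le (fun ⟨l, hl⟩ => ?_) (by positivity)
  have hlL : L ≤ l := by
    by_contra! hlt
    exact absurd (hl ▸ Finset.le_sup (f := n) (Finset.mem_range.2 hlt)) hN.not_ge
  rw [le_div_iff₀ hNc, mul_comm]
  exact (congrArg (fun j : ℕ => (j : ℝ) ^ c * _) hl).symm.trans_le (hL l hlL)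

end Asymptotic

end PolySystem

open PolySystem
theorem mainTheorem3
    (n m : ℕ → ℕ)
    (hn : (fun l : ℕ => (n l : ℝ)) =Θ[atTop] (fun l : ℕ => (l : ℝ)))
    (hm : (fun l : ℕ => Real.log (n l)) =o[atTop] (fun l : ℕ => (m l : ℝ)))
    (ε α : ℝ) (hε₀ : 0 < ε) (hε₁ : ε < 1 / 6)
    (hα₀ : 7 / 8 + 3 / 4 * ε < α) (hα₁ : α < 1) :
    ∃ δ η : ℕ → ℝ,
      Negligible δ ∧ (∀ N, 0 ≤ δ N ∧ δ N ≤ 1) ∧ Negligible η ∧ (∀ N, 0 ≤ η N ∧ η N ≤ 1) ∧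
      ∀ᶠ l : ℕ in atTop,
        ∀ (K : Type) [Field K] [Fintype K] [Algebra (ZMod 2) K]
          (φ : K ≃ₗ[ZMod 2] (Fin (n l) → ZMod 2))
          (γ : Fin (m l) → K) (_ : Function.Injective γ)
          (k : ℕ) (_ : |(k : ℝ) - (1 - α) * m l| < 1)
          (D : Fin (m l) → PMF (BoolPoly (n l)))
          (_ : ∀ i, ShiftInvariant (D i)) (_ : ∀ i, TwoWiseIndependent (D i)),
          1 - η (n l) ≤ (systemLaw D).real {P | badMass γ k ε φ P ≤ δ l} := by
  have hρ : 0 < ε ^ 2 := by positivity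
  refine ⟨fun l => min 1 (2 * Real.exp (-(ε ^ 2 * m l))), fiberSup n m (ε ^ 2),
    negligible_exp hn hm hρ, fun N => ⟨by positivity, min_le_left _ _⟩,
    negligible_fiberSup hn hm hρ, fun N => ⟨fiberSup_nonneg n m _ N, fiberSup_le_one hρ N⟩, ?_⟩
  -- The last threshold makes `2 * exp (-(ε ^ 2 * m))` at most 1, so the truncation that keeps δ in
  -- [0, 1] is inactive.
  filter_upwards [eventually_ge_of_isTheta hn 32, eventually_ge_of_log_isLittleO hn hm 16,
    eventually_ge_of_log_isLittleO hn hm (Real.log 2 / ε ^ 2)] with l hn32 hm16 hmlog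
  intro K _ _ _ φ γ hγ k hk D hs h2
  have ht : 2 * Real.exp (-(ε ^ 2 * m l)) ≤ 1 := by
    rw [div_le_iff₀ hρ] at hmlog
    calc 2 * Real.exp (-(ε ^ 2 * m l)) ≤ 2 * Real.exp (-Real.log 2) := by
          gcongr; linarith
      _ = 1 := by rw [Real.exp_neg, Real.exp_log two_pos]; norm_num
  rw [min_eq_right ht]
  exact (sub_le_sub_left (le_fiberSup hρ l) 1).trans
    (one_sub_le_measureReal_badMass_le hε₀ hε₁ hα₀ (by exact_mod_cast hm16)
      (by exact_mod_cast hn32) φ hγ hk hs h2)
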